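/- Let $\mathbf E=L^2[0,1]\times L^2[0,1]$ (real-valued functions), and let $h(t)=t-t^{-1}$, a diffeomorphism $(0,+\infty)\to\mathbb R$, and $h_{-1,+1}(t)=(-1-t)^{-1}+(1-t)^{-1}$, a diffeomorphism $(-1,1)\to\mathbb R$. To $(\hat\sigma,\hat\kappa)\in\mathbf E$ associate the speed $\sigma=h^{-1}\circ\hat\sigma$, the curvature $\kappa=h_{-1,+1}^{-1}\circ\hat\kappa$, and the curve $\gamma\colon[0,1]\to\mathbb C$ with unit tangent $\tau\colon[0,1]\to\mathbb S^1$ given by the unique absolutely continuous solution of $$\dot\gamma=\sigma\tau,\qquad \dot\tau=\sigma\kappa\, i\tau \quad\text{a.e.},\qquad \gamma(0)=0,\ \tau(0)=1 .$$ Let $\theta\colon[0,1]\to\mathbb R$ be the continuous function with $\tau=e^{i\theta}$ and $\theta(0)=0$; the total turning of $\gamma$ is $\theta(1)-\theta(0)$, and its amplitude is $\omega=\sup_{[0,1]}\theta-\inf_{[0,1]}\theta$. The curve $\gamma$ is called condensed, critical or diffuse according as $\omega<\pi$, $\omega=\pi$ or $\omega>\pi$. Let $Q=(q,z)\in\mathbb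 C\times\mathbb S^1$ and let $\theta_1\in\mathbb R$ satisfy $e^{i\theta_1}=z$. Let $\mathcal L_{-1}^{+1}(Q;\theta_1)$ be the set of all such curves with $\gamma(1)=q$, $\tau(1)=z$ and total turning $\theta_1$, identified with a subset of $\mathbf E$ through $\gamma\leftrightarrow(\hat\sigma,\hat\kappa)$ and given the subspace topology. Let $\mathcal U_c,\mathcal U_d,\mathcal T\subset\mathcal L_{-1}^{+1}(Q;\theta_1)$ be the subsets of condensed, diffuse and critical curves, respectively. If $|\theta_1|<\pi$, then the topological boundaries and closures in $\mathcal L_{-1}^{+1}(Q;\theta_1)$ satisfy $$\partial\,\mathcal U_c=\partial\,\mathcal U_d=\mathcal T,\qquad \overline{\mathcal U_c}\cup\overline{\mathcal U_d}=\mathcal L_{-1}^{+1}(Q;\theta_1),\qquad \overline{\mathcal U_c}\cap\overline{\mathcal U_d}=\mathcal T .$$ -/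

import Mathlib

open MeasureTheory Set

noncomputable section

namespace ConstrainedCurves

/-- The closed unit interval `[0,1]` with Lebesgue measure (as a measure on `ℝ`). -/
abbrev unitMeasure : Measure ℝ := volume.restrict (Icc (0 : ℝ) 1)

/-- The space `𝐄 = L²[0,1] × L²[0,1]`.  Only its topology matters below, and the topology of the
product norm is the topology of the Hilbert norm. -/
abbrev E : Type := Lp ℝ 2 unitMeasure × Lp ℝ 2 unitMeasure

/-- The diffeomorphism `h = h_{0,+∞} : (0,+∞) → ℝ`, `h t = t - t⁻¹`. -/
def h (t : ℝ) : ℝ := t - t⁻¹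

/-- The diffeomorphism `h_{-1,+1} : (-1,1) → ℝ`, `h t = (-1 - t)⁻¹ + (1 - t)⁻¹`. -/
def hCurv (t : ℝ) : ℝ := (-1 - t)⁻¹ + (1 - t)⁻¹

/-- The inverse `ℝ → (0,+∞)` of `h`, in closed form (see `h_hInv` and `hInv_h`). -/
def hInv (x : ℝ) : ℝ := (x + √(x ^ 2 + 4)) / 2

/-- The inverse `ℝ → (-1,1)` of `hCurv`, in closed form (see `hCurv_hCurvInv` and
`hCurvInv_hCurv`). -/
def hCurvInv (x : ℝ) : ℝ := x / (1 + √(1 + x ^ 2))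

lemma hInv_pos (x : ℝ) : 0 < hInv x := by
  have h1 : |x| < √(x ^ 2 + 4) := by
    rw [← Real.sqrt_sq_eq_abs]; exact Real.sqrt_lt_sqrt (sq_nonneg x) (by linarith)
  have h2 := neg_abs_le x
  unfold hInv; linarith

lemma h_hInv (x : ℝ) : h (hInv x) = x := by
  have h0 := hInv_pos x
  have hs : √(x ^ 2 + 4) ^ 2 = x ^ 2 + 4 := Real.sq_sqrt (by positivity)
  have h1 : hInv x ^ 2 = x * hInv x + 1 := by unfold hInv; nlinarith
  unfold h; field_simp; nlinarith

lemma hInv_h {t : ℝ} (ht : 0 < t) : hInv (h t) = t := by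
  have : √(h t ^ 2 + 4) = t + t⁻¹ := by
    rw [Real.sqrt_eq_iff_mul_self_eq_of_pos (by positivity)]
    unfold h; field_simp; ring
  unfold hInv; rw [this]; unfold h; ring

lemma abs_hCurvInv_lt_one (x : ℝ) : |hCurvInv x| < 1 := by
  have h1 : |x| ≤ √(1 + x ^ 2) := by
    rw [← Real.sqrt_sq_eq_abs]; exact Real.sqrt_le_sqrt (by linarith)
  have h2 : 0 < 1 + √(1 + x ^ 2) := by positivity
  unfold hCurvInv
  rw [abs_div, abs_of_pos h2, div_lt_one h2]; linarith

lemma hCurv_hCurvInv (x : ℝ) : hCurv (hCurvInv x) = x := by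
  have h0 := abs_lt.mp (abs_hCurvInv_lt_one x)
  have hs : √(1 + x ^ 2) ^ 2 = 1 + x ^ 2 := Real.sq_sqrt (by positivity)
  have hp : 0 < 1 + √(1 + x ^ 2) := by positivity
  have h1 : x * hCurvInv x ^ 2 + 2 * hCurvInv x = x := by
    unfold hCurvInv; field_simp; linear_combination -x * hs
  have h2 : -1 - hCurvInv x ≠ 0 := by linarith
  have h3 : 1 - hCurvInv x ≠ 0 := by linarith
  unfold hCurv; field_simp; nlinarith

lemma hCurvInv_hCurv {t : ℝ} (ht : t ∈ Ioo (-1 : ℝ) 1) : hCurvInv (hCurv t) = t := by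
  obtain ⟨h1, h2⟩ := ht
  have h3 : -1 - t ≠ 0 := by linarith
  have h4 : 1 - t ≠ 0 := by linarith
  have h5 : 0 < 1 - t ^ 2 := by nlinarith
  have hc : hCurv t = 2 * t / (1 - t ^ 2) := by
    unfold hCurv; field_simp; ring
  have : √(1 + hCurv t ^ 2) = (1 + t ^ 2) / (1 - t ^ 2) := by
    rw [Real.sqrt_eq_iff_mul_self_eq_of_pos (by positivity), hc]
    field_simp; ring
  unfold hCurvInv; rw [this, hc]; field_simp; ring

/-- The speed `σ = h⁻¹ ∘ σ̂` of the admissible curve with parameters `(σ̂, κ̂) ∈ 𝐄`. -/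
def speed (p : E) (t : ℝ) : ℝ := hInv (p.1 t)

/-- The curvature `κ = h_{-1,+1}⁻¹ ∘ κ̂` of the admissible curve with parameters `(σ̂, κ̂) ∈ 𝐄`. -/
def curvature (p : E) (t : ℝ) : ℝ := hCurvInv (p.2 t)

/-- The argument `θ : [0,1] → ℝ` of the unit tangent with `θ 0 = 0` (so `θ' = σ κ`). -/
def argument (p : E) (t : ℝ) : ℝ := ∫ s in (0 : ℝ)..t, speed p s * curvature p s

/-- The unit tangent `exp (i θ)`. -/
def tangent (p : E) (t : ℝ) : Circle := Circle.exp (argument p t)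

/-- The `(-1,+1)`-admissible plane curve with parameters `(σ̂, κ̂)` and initial frame `(0, 1)`. -/
def curve (p : E) (t : ℝ) : ℂ := ∫ s in (0 : ℝ)..t, (speed p s : ℂ) * (tangent p s : ℂ)

/-- The frame `Φ = (γ, τ)`, with values in the unit tangent bundle `ℂ × 𝕊¹` of the plane. -/
def frame (p : E) (t : ℝ) : ℂ × Circle := (curve p t, tangent p t)

/-- `(γ, τ)` solves on `[0,1]`, in the sense of Carathéodory, the initial value problem
`γ' = σ τ`, `τ' = σ κ (i τ)`, `(γ, τ)(0) = (0, 1)`, which defines admissible curves of speed `σ`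
and curvature `κ`. -/
structure SolvesFrameIVP (σ κ : ℝ → ℝ) (γ τ : ℝ → ℂ) : Prop where
  absCont_curve : AbsolutelyContinuousOnInterval γ 0 1
  absCont_tangent : AbsolutelyContinuousOnInterval τ 0 1
  curve_zero : γ 0 = 0
  tangent_zero : τ 0 = 1
  deriv_curve : ∀ᵐ t : ℝ, t ∈ Icc (0 : ℝ) 1 → HasDerivAt γ (σ t * τ t) t
  deriv_tangent : ∀ᵐ t : ℝ, t ∈ Icc (0 : ℝ) 1 →
    HasDerivAt τ (σ t * κ t * (Complex.I * τ t)) t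

lemma absCont_of_dist_le {X Y : Type*} [PseudoMetricSpace X] [PseudoMetricSpace Y]
    {f : ℝ → X} {g : ℝ → Y} {a b : ℝ} (hf : AbsolutelyContinuousOnInterval f a b)
    (hfg : ∀ x ∈ uIcc a b, ∀ y ∈ uIcc a b, dist (g x) (g y) ≤ dist (f x) (f y)) :
    AbsolutelyContinuousOnInterval g a b := by
  rw [absolutelyContinuousOnInterval_iff] at hf ⊢
  intro ε hε
  obtain ⟨δ, hδ, H⟩ := hf ε hε
  refine ⟨δ, hδ, fun F hF hl => lt_of_le_of_lt (Finset.sum_le_sum fun i hi => ?_) (H F hF hl)⟩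
  exact hfg _ (hF.1 i hi).1 _ (hF.1 i hi).2

lemma speed_pos (p : E) (t : ℝ) : 0 < speed p t := hInv_pos _

lemma abs_curvature_lt_one (p : E) (t : ℝ) : |curvature p t| < 1 := abs_hCurvInv_lt_one _

lemma continuous_hInv : Continuous hInv := by unfold hInv; fun_prop

lemma continuous_hCurvInv : Continuous hCurvInv := by
  unfold hCurvInv
  exact continuous_id.div (by fun_prop) fun x => by positivity

lemma hInv_le (x : ℝ) : hInv x ≤ |x| + 1 := by
  have : √(x ^ 2 + 4) ≤ |x| + 2 := by
    rw [Real.sqrt_le_left (by positivity)]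
    have := sq_abs x
    nlinarith [abs_nonneg x]
  have := le_abs_self x
  unfold hInv; linarith

lemma intervalIntegrable_speed (p : E) : IntervalIntegrable (speed p) volume 0 1 := by
  rw [intervalIntegrable_iff_integrableOn_Icc_of_le zero_le_one]
  have h1 : Integrable (p.1 : ℝ → ℝ) unitMeasure :=
    (Lp.memLp p.1).integrable (by norm_num)
  refine (h1.abs.add (integrable_const (1 : ℝ))).mono'
    (continuous_hInv.comp_aestronglyMeasurable h1.1) (.of_forall fun t => ?_)
  rw [Real.norm_of_nonneg (speed_pos p t).le]
  exact hInv_le _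

lemma intervalIntegrable_speed_mul_curvature (p : E) :
    IntervalIntegrable (fun s => speed p s * curvature p s) volume 0 1 := by
  have h0 := intervalIntegrable_speed p
  rw [intervalIntegrable_iff_integrableOn_Icc_of_le zero_le_one] at h0 ⊢
  have h2 : AEStronglyMeasurable (curvature p) unitMeasure :=
    continuous_hCurvInv.comp_aestronglyMeasurable (Lp.memLp p.2).1
  refine h0.mono' (h0.1.mul h2) (.of_forall fun t => ?_)
  rw [norm_mul, Real.norm_of_nonneg (speed_pos p t).le]
  exact mul_le_of_le_one_right (speed_pos p t).le (abs_curvature_lt_one p t).le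

lemma absCont_argument (p : E) : AbsolutelyContinuousOnInterval (argument p) 0 1 :=
  (intervalIntegrable_speed_mul_curvature p).absolutelyContinuousOnInterval_intervalIntegral
    (by simp)

lemma argument_zero (p : E) : argument p 0 = 0 := by simp [argument]

lemma continuousOn_argument (p : E) : ContinuousOn (argument p) (Icc 0 1) := by
  simpa [uIcc_of_le] using (absCont_argument p).continuousOn

lemma coe_tangent (p : E) (t : ℝ) :
    (tangent p t : ℂ) = Complex.exp (argument p t * Complex.I) := by simp [tangent]

lemma intervalIntegrable_velocity (p : E) :
    IntervalIntegrable (fun s => (speed p s : ℂ) * (tangent p s : ℂ)) volume 0 1 := by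
  simp only [coe_tangent]
  have h0 := intervalIntegrable_speed p
  rw [intervalIntegrable_iff_integrableOn_Icc_of_le zero_le_one] at h0 ⊢
  refine h0.ofReal.mul_bdd (c := 1) ?_ (.of_forall fun t =>
    (Complex.norm_exp_ofReal_mul_I _).le)
  refine ContinuousOn.aestronglyMeasurable ?_ measurableSet_Icc
  have := continuousOn_argument p
  fun_prop

/-- The frame of a parameter pair is a solution of the defining initial value problem. -/
theorem solvesFrameIVP_frame (p : E) :
    SolvesFrameIVP (speed p) (curvature p) (fun t => (frame p t).1)
      (fun t => ((frame p t).2 : ℂ)) where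
  absCont_curve := by
    refine absCont_of_dist_le ((intervalIntegrable_speed p).absolutelyContinuousOnInterval_intervalIntegral
      (c := 0) (by simp)) fun x hx y hy => ?_
    have h0 : (0 : ℝ) ∈ uIcc (0 : ℝ) 1 := by simp
    have hv := intervalIntegrable_velocity p
    have hs := intervalIntegrable_speed p
    have sub : ∀ {u v : ℝ}, u ∈ uIcc (0 : ℝ) 1 → v ∈ uIcc (0 : ℝ) 1 →
        uIcc u v ⊆ uIcc 0 1 := fun hu hv => uIcc_subset_uIcc hu hv
    rw [dist_comm, dist_comm (∫ s in (0 : ℝ)..x, speed p s)]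
    simp only [frame, curve, dist_eq_norm]
    rw [intervalIntegral.integral_interval_sub_left (hv.mono_set (sub h0 hy))
      (hv.mono_set (sub h0 hx)), intervalIntegral.integral_interval_sub_left
      (hs.mono_set (sub h0 hy)) (hs.mono_set (sub h0 hx))]
    refine (intervalIntegral.norm_integral_le_abs_integral_norm).trans_eq ?_
    congr 1
    refine intervalIntegral.integral_congr fun s _ => ?_
    simp only [norm_mul, coe_tangent, Complex.norm_exp_ofReal_mul_I, mul_one,
      Complex.norm_real, Real.norm_of_nonneg (speed_pos p s).le]
  absCont_tangent := by
    refine absCont_of_dist_le (absCont_argument p) fun x _ y _ => ?_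
    simp only [frame, coe_tangent, dist_eq_norm]
    have : Complex.exp (argument p x * Complex.I) - Complex.exp (argument p y * Complex.I)
        = Complex.exp (argument p y * Complex.I) *
          (Complex.exp (Complex.I * ((argument p x - argument p y : ℝ) : ℂ)) - 1) := by
      rw [mul_sub, mul_one, ← Complex.exp_add]
      congr 2
      push_cast; ring
    rw [this, norm_mul, Complex.norm_exp_ofReal_mul_I, one_mul]
    exact Real.norm_exp_I_mul_ofReal_sub_one_le
  curve_zero := by simp [frame, curve]
  tangent_zero := by simp [frame, tangent, argument_zero]
  deriv_curve := by
    filter_upwards [(intervalIntegrable_velocity p).ae_hasDerivAt_integral] with t ht hmem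
    exact ht (by simpa [uIcc_of_le] using hmem) 0 (by simp)
  deriv_tangent := by
    filter_upwards [(intervalIntegrable_speed_mul_curvature p).ae_hasDerivAt_integral]
      with t ht hmem
    have h1 : HasDerivAt (argument p) _ t := ht (by simpa [uIcc_of_le] using hmem) 0 (by simp)
    have h2 := (h1.ofReal_comp.mul_const Complex.I).cexp
    simp only [frame, coe_tangent]
    convert! h2 using 1
    push_cast; ring

/-- The frame of a parameter pair is the only solution of the defining initial value problem. -/
theorem SolvesFrameIVP.eqOn_frame {p : E} {γ τ : ℝ → ℂ}
    (H : SolvesFrameIVP (speed p) (curvature p) γ τ) :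
    EqOn γ (fun t => (frame p t).1) (Icc 0 1) ∧
      EqOn τ (fun t => ((frame p t).2 : ℂ)) (Icc 0 1) := by
  have K := solvesFrameIVP_frame p
  have hI : uIcc (0 : ℝ) 1 = Icc 0 1 := uIcc_of_le zero_le_one
  have hτ : EqOn τ (fun t => ((frame p t).2 : ℂ)) (Icc 0 1) := by
    have hac : AbsolutelyContinuousOnInterval
        (fun t => (starRingEnd ℂ) ((frame p t).2 : ℂ) • τ t) 0 1 := by
      refine AbsolutelyContinuousOnInterval.fun_smul ?_ H.absCont_tangent
      refine absCont_of_dist_le K.absCont_tangent fun x _ y _ => ?_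
      rw [dist_eq_norm, dist_eq_norm, ← map_sub, RCLike.norm_conj]
    obtain ⟨C, hC⟩ := hac.const_of_ae_hasDerivAt_zero (by
      filter_upwards [H.deriv_tangent, K.deriv_tangent] with t h1 h2 ht
      rw [hI] at ht
      have h3 : HasDerivAt (fun t => (starRingEnd ℂ) ((frame p t).2 : ℂ)) _ t := (h2 ht).star
      convert! h3.smul (h1 ht) using 1
      rw [← starRingEnd_apply]
      simp only [smul_eq_mul, map_mul, Complex.conj_I, Complex.conj_ofReal]
      ring)
    have hC1 : C = 1 := by
      rw [← hC 0 (by simp), H.tangent_zero]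
      rw [show ((frame p 0).2 : ℂ) = 1 from K.tangent_zero, map_one, one_smul]
    intro t ht
    have := hC t (hI ▸ ht)
    rw [hC1, smul_eq_mul] at this
    have h4 : ((frame p t).2 : ℂ) * (starRingEnd ℂ) ((frame p t).2 : ℂ) = 1 := by
      rw [Complex.mul_conj, Complex.normSq_eq_norm_sq]
      simp only [frame, coe_tangent, Complex.norm_exp_ofReal_mul_I]
      norm_num
    calc τ t = (((frame p t).2 : ℂ) * (starRingEnd ℂ) ((frame p t).2 : ℂ)) * τ t := by
          rw [h4, one_mul]
      _ = _ := by rw [mul_assoc, this, mul_one]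
  refine ⟨?_, hτ⟩
  obtain ⟨C, hC⟩ := (H.absCont_curve.fun_sub K.absCont_curve).const_of_ae_hasDerivAt_zero (by
    filter_upwards [H.deriv_curve, K.deriv_curve] with t h1 h2 ht
    rw [hI] at ht
    convert! (h1 ht).sub (h2 ht) using 1
    rw [hτ ht, sub_self])
  have hC0 : C = 0 := by
    rw [← hC 0 (by simp), H.curve_zero, K.curve_zero, sub_zero]
  intro t ht
  have := hC t (hI ▸ ht)
  rw [hC0] at this
  exact sub_eq_zero.mp this

/-- Every argument of the unit tangent (every continuous `θ` on `[0,1]` with `exp (i θ)` equal to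
the tangent) differs from `argument p` by a constant.  So the total turning and the amplitude,
defined next, may be computed with any argument. -/
theorem exists_eq_argument_add_const {p : E} {θ : ℝ → ℝ} (hc : ContinuousOn θ (Icc 0 1))
    (hθ : ∀ t ∈ Icc (0 : ℝ) 1, Circle.exp (θ t) = tangent p t) :
    ∃ c, ∀ t ∈ Icc (0 : ℝ) 1, θ t = argument p t + c := by
  have key : ∀ t ∈ Icc (0 : ℝ) 1, ∃ m : ℤ, (θ t - argument p t) / (2 * Real.pi) = m := by
    intro t ht
    obtain ⟨m, hm⟩ := Circle.exp_eq_exp.mp (hθ t ht)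
    exact ⟨m, by rw [hm]; field_simp; ring⟩
  have hcont : ContinuousOn (fun t => (θ t - argument p t) / (2 * Real.pi)) (Icc 0 1) :=
    (hc.sub (continuousOn_argument p)).div_const _
  have hconst := isPreconnected_Icc.eqOn_const_of_mapsTo
    (T := range ((↑) : ℤ → ℝ)) (Int.isClosedEmbedding_coe_real.isDiscrete_range) hcont
    (fun t ht => let ⟨m, hm⟩ := key t ht; ⟨m, hm.symm⟩) ⟨0, 0, by simp⟩
  obtain ⟨y, -, hy⟩ := hconst
  refine ⟨y * (2 * Real.pi), fun t ht => ?_⟩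
  have := hy ht
  simp only [Function.const] at this
  rw [div_eq_iff (by positivity)] at this
  linarith

/-- The total turning `θ(1) - θ(0)` of a curve whose unit tangent has argument `θ`. -/
def totalTurning (θ : ℝ → ℝ) : ℝ := θ 1 - θ 0

/-- The amplitude `sup θ - inf θ` over `[0,1]` of a curve whose unit tangent has argument `θ`. -/
def amplitude (θ : ℝ → ℝ) : ℝ := sSup (θ '' Icc 0 1) - sInf (θ '' Icc 0 1)

/-- The space `𝓛_{-1}^{+1}(Q; θ₁)` of `(-1,+1)`-admissible curves with initial frame `(0, 1)`,
final frame `Q` and total turning `θ₁`, as a subset of `𝐄`; coerced to a type, it carries the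
subspace topology. -/
def curveSpace (Q : ℂ × Circle) (θ₁ : ℝ) : Set E :=
  {p | frame p 1 = Q ∧ totalTurning (argument p) = θ₁}

/-- The set `𝓤_c` of condensed curves. -/
def condensed (Q : ℂ × Circle) (θ₁ : ℝ) : Set (curveSpace Q θ₁) :=
  {p | amplitude (argument p) < Real.pi}

/-- The set `𝓤_d` of diffuse curves. -/
def diffuse (Q : ℂ × Circle) (θ₁ : ℝ) : Set (curveSpace Q θ₁) :=
  {p | Real.pi < amplitude (argument p)}

/-- The set `𝓣` of critical curves. -/
def critical (Q : ℂ × Circle) (θ₁ : ℝ) : Set (curveSpace Q θ₁) :=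
  {p | amplitude (argument p) = Real.pi}

end ConstrainedCurves

end

noncomputable section

open Filter Topology

namespace ConstrainedCurves

/-! The amplitude `ω` depends continuously on the parameters (`continuous_amplitude_argument`), so
condensed and diffuse curves form open sets whose closures lie in `ω ≤ π` and `π ≤ ω`. Everything
else follows once each critical curve is a limit of condensed curves and of diffuse curves inside
the curve space.

To move a critical curve, replace `θ` by `θ + εψ` with `ψ(0) = ψ(1) = 0`. If `ψ` is close to `θ₁ t -
θ(t)`, the result is close to the convex combination `(1 - ε)θ + ε θ₁ t`, of amplitude at most `(1 -
ε)π + ε|θ₁| < π`. If instead `ψ` increases by `1` from a minimum to a maximum of `θ`, the amplitude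
exceeds `π`; such a `ψ` exists because the minimum and maximum are not the two end points, again by
`|θ₁| < π`.

The end point has to be restored (`eventually_exists_mem_curveSpace`). An argument of amplitude `π`
spends positive time in each open half of its range, so changing the speed on two suitable sets
moves the end point in two independent directions. Changing `σ` with `θ' = σκ` prescribed leaves the
argument alone, so this correction is a 2×2 real linear system.

Small changes of `σ` or `κ` can be large in `𝐄` where `σ` is near `0` or `κ` near `±1`; hence all
changes are confined to times with bounded parameters. -/

instance : IsProbabilityMeasure unitMeasure := ⟨by simp [unitMeasure]⟩

/-! ### Integrals over `[0,1]`. -/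

lemma intervalIntegral_eq_integral_unitMeasure {F : Type*} [NormedAddCommGroup F] [NormedSpace ℝ F]
    (f : ℝ → F) : ∫ s in (0 : ℝ)..1, f s = ∫ s, f s ∂unitMeasure := by
  rw [intervalIntegral.integral_of_le zero_le_one, integral_Icc_eq_integral_Ioc]

lemma intervalIntegrable_iff_integrable_unitMeasure {F : Type*} [NormedAddCommGroup F]
    {f : ℝ → F} : IntervalIntegrable f volume 0 1 ↔ Integrable f unitMeasure :=
  intervalIntegrable_iff_integrableOn_Icc_of_le zero_le_one

lemma uIcc_zero_subset {t : ℝ} (ht : t ∈ Icc (0 : ℝ) 1) : uIcc 0 t ⊆ uIcc 0 1 := by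
  rw [uIcc_of_le ht.1, uIcc_of_le zero_le_one]; exact Icc_subset_Icc_right ht.2

lemma abs_intervalIntegral_le_integral_abs {f : ℝ → ℝ} (hf : Integrable f unitMeasure) {t : ℝ}
    (ht : t ∈ Icc (0 : ℝ) 1) : |∫ s in (0 : ℝ)..t, f s| ≤ ∫ s, |f s| ∂unitMeasure := by
  rw [← intervalIntegral_eq_integral_unitMeasure]
  refine (intervalIntegral.abs_integral_le_integral_abs ht.1).trans ?_
  exact intervalIntegral.integral_mono_interval le_rfl ht.1 ht.2
    (.of_forall fun _ => abs_nonneg _) (intervalIntegrable_iff_integrable_unitMeasure.mpr hf).abs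

/-! ### Continuity of the amplitude in the parameters. -/

/-- The difference quotient of `h` is `1 + 1/(st) ≥ 1`; hence the inverse is 1-Lipschitz. -/
lemma abs_sub_le_abs_h_sub {s t : ℝ} (hs : 0 < s) (ht : 0 < t) : |s - t| ≤ |h s - h t| := by
  have : h s - h t = (s - t) * (1 + (s * t)⁻¹) := by
    unfold h; field_simp; ring
  rw [this, abs_mul]
  refine le_mul_of_one_le_right (abs_nonneg _) ?_
  have : 0 < (s * t)⁻¹ := by positivity
  rw [abs_of_pos (by linarith)]; linarith

lemma abs_hInv_sub_le (x y : ℝ) : |hInv x - hInv y| ≤ |x - y| := by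
  simpa only [h_hInv] using abs_sub_le_abs_h_sub (hInv_pos x) (hInv_pos y)

lemma abs_sub_le_abs_hCurv_sub {s t : ℝ} (hs : |s| < 1) (ht : |t| < 1) :
    |s - t| ≤ |hCurv s - hCurv t| := by
  have hs' := abs_lt.mp hs
  have ht' := abs_lt.mp ht
  have e1 : -1 - s ≠ 0 := by linarith
  have e2 : 1 - s ≠ 0 := by linarith
  have e3 : -1 - t ≠ 0 := by linarith
  have e4 : 1 - t ≠ 0 := by linarith
  have e5 : 0 < 1 - s ^ 2 := by nlinarith
  have e6 : 0 < 1 - t ^ 2 := by nlinarith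
  have : hCurv s - hCurv t = (s - t) * (2 * (1 + s * t) / ((1 - s ^ 2) * (1 - t ^ 2))) := by
    have c1 : hCurv s = 2 * s / (1 - s ^ 2) := by unfold hCurv; field_simp; ring
    have c2 : hCurv t = 2 * t / (1 - t ^ 2) := by unfold hCurv; field_simp; ring
    rw [c1, c2]; field_simp; ring
  rw [this, abs_mul]
  refine le_mul_of_one_le_right (abs_nonneg _) (le_trans ?_ (le_abs_self _))
  rw [one_le_div (by positivity)]
  have h1 : s ^ 2 * t ^ 2 ≤ t ^ 2 := by nlinarith [sq_nonneg t]
  -- The difference of the two sides is `1 + (s + t)² - s²t²`.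
  nlinarith [sq_nonneg (s + t), sq_nonneg s, sq_nonneg t]

lemma abs_hCurvInv_sub_le (x y : ℝ) : |hCurvInv x - hCurvInv y| ≤ |x - y| := by
  simpa only [hCurv_hCurvInv] using
    abs_sub_le_abs_hCurv_sub (abs_hCurvInv_lt_one x) (abs_hCurvInv_lt_one y)

lemma memLp_speed (p : E) : MemLp (speed p) 2 unitMeasure := by
  have h1 : MemLp (fun t => |p.1 t| + 1) 2 unitMeasure :=
    (Lp.memLp p.1).norm.add (memLp_const 1)
  refine h1.mono (continuous_hInv.comp_aestronglyMeasurable (Lp.memLp p.1).1)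
    (.of_forall fun t => ?_)
  rw [Real.norm_of_nonneg (speed_pos p t).le]
  exact (hInv_le _).trans (le_abs_self _)

lemma integrable_mul_abs {w : ℝ → ℝ} (hw : MemLp w 2 unitMeasure) (f : Lp ℝ 2 unitMeasure) :
    Integrable (fun t => w t * |f t|) unitMeasure :=
  hw.integrable_mul (Lp.memLp f).norm

/-- Cauchy–Schwarz in `L²[0,1]`. -/
lemma integral_mul_abs_le {w : ℝ → ℝ} (hw : MemLp w 2 unitMeasure) (f : Lp ℝ 2 unitMeasure) :
    ∫ t, w t * |f t| ∂unitMeasure ≤ ‖hw.toLp w‖ * ‖f‖ := by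
  have h1 := real_inner_le_norm (hw.toLp w) |f|
  rw [norm_abs_eq_norm, L2.inner_def] at h1
  refine le_of_eq_of_le (integral_congr_ae ?_) h1
  filter_upwards [hw.coeFn_toLp, Lp.coeFn_abs f] with t h2 h3
  simp only [h2, h3, RCLike.inner_apply, conj_trivial]
  ring

/-- The difference of the `σκ` splits so that the speed difference is multiplied by a curvature,
bounded by `1`, and the curvature difference by the speed of `p` alone. The constants therefore do
not depend on `q` or `t`. -/
lemma abs_argument_sub_le (p q : E) {t : ℝ} (ht : t ∈ Icc (0 : ℝ) 1) :
    |argument q t - argument p t| ≤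
      ‖(memLp_const (1 : ℝ) : MemLp (fun _ => (1 : ℝ)) 2 unitMeasure).toLp _‖ * ‖q.1 - p.1‖
        + ‖(memLp_speed p).toLp _‖ * ‖q.2 - p.2‖ := by
  have hp := intervalIntegrable_speed_mul_curvature p
  have hq := intervalIntegrable_speed_mul_curvature q
  have hsub := uIcc_zero_subset ht
  unfold argument
  rw [← intervalIntegral.integral_sub (hq.mono_set hsub) (hp.mono_set hsub)]
  refine (abs_intervalIntegral_le_integral_abs
    (intervalIntegrable_iff_integrable_unitMeasure.mp (hq.sub hp)) ht).trans ?_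
  have i1 := integrable_mul_abs (memLp_const (1 : ℝ) : MemLp (fun _ => (1 : ℝ)) 2 unitMeasure)
    (q.1 - p.1)
  have i2 := integrable_mul_abs (memLp_speed p) (q.2 - p.2)
  refine le_trans ?_ (add_le_add (integral_mul_abs_le _ _) (integral_mul_abs_le _ _))
  rw [← integral_add i1 i2]
  refine integral_mono_ae
    (intervalIntegrable_iff_integrable_unitMeasure.mp (hq.sub hp).abs) (i1.add i2) ?_
  filter_upwards [Lp.coeFn_sub q.1 p.1, Lp.coeFn_sub q.2 p.2] with s h2 h3
  simp only [h2, h3, Pi.sub_apply, one_mul]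
  have e1 : |speed q s - speed p s| ≤ |q.1 s - p.1 s| := abs_hInv_sub_le _ _
  have e2 : |curvature q s - curvature p s| ≤ |q.2 s - p.2 s| := abs_hCurvInv_sub_le _ _
  have e3 := (abs_curvature_lt_one q s).le
  have e4 := (speed_pos p s).le
  calc |speed q s * curvature q s - speed p s * curvature p s|
      = |(speed q s - speed p s) * curvature q s
          + speed p s * (curvature q s - curvature p s)| := by ring_nf
    _ ≤ |speed q s - speed p s| * |curvature q s|
          + speed p s * |curvature q s - curvature p s| := by
        refine (abs_add_le _ _).trans ?_
        rw [abs_mul, abs_mul, abs_of_nonneg e4]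
    _ ≤ |q.1 s - p.1 s| + speed p s * |q.2 s - p.2 s| := by
        gcongr
        exact (mul_le_of_le_one_right (abs_nonneg _) e3).trans e1

/-- The amplitude of a continuous function is attained. -/
lemma exists_amplitude_eq {f : ℝ → ℝ} (hf : ContinuousOn f (Icc 0 1)) :
    ∃ s ∈ Icc (0 : ℝ) 1, ∃ t ∈ Icc (0 : ℝ) 1, (∀ x ∈ Icc (0 : ℝ) 1, f s ≤ f x ∧ f x ≤ f t) ∧
      amplitude f = f t - f s := by
  have hne : (Icc (0 : ℝ) 1).Nonempty := ⟨0, by simp⟩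
  obtain ⟨s, hs, hs'⟩ := isCompact_Icc.exists_sInf_image_eq_and_le hne hf
  obtain ⟨t, ht, ht'⟩ := isCompact_Icc.exists_sSup_image_eq_and_ge hne hf
  exact ⟨s, hs, t, ht, fun x hx => ⟨hs'.2 x hx, ht'.2 x hx⟩, by
    rw [amplitude, hs'.1, ht'.1]⟩

lemma sub_le_amplitude {f : ℝ → ℝ} (hf : ContinuousOn f (Icc 0 1)) {s t : ℝ}
    (hs : s ∈ Icc (0 : ℝ) 1) (ht : t ∈ Icc (0 : ℝ) 1) : f t - f s ≤ amplitude f := by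
  obtain ⟨a, -, b, -, hab, h⟩ := exists_amplitude_eq hf
  have := (hab s hs).1
  have := (hab t ht).2
  linarith

lemma amplitude_le_add {f g : ℝ → ℝ} (hf : ContinuousOn f (Icc 0 1))
    (hg : ContinuousOn g (Icc 0 1)) {C : ℝ} (hfg : ∀ t ∈ Icc (0 : ℝ) 1, |f t - g t| ≤ C) :
    amplitude f ≤ amplitude g + 2 * C := by
  obtain ⟨a, ha, b, hb, -, h⟩ := exists_amplitude_eq hf
  have h1 := sub_le_amplitude hg ha hb
  have h2 := abs_le.mp (hfg a ha)
  have h3 := abs_le.mp (hfg b hb)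
  linarith [h2.1, h3.2]

lemma continuous_amplitude_argument : Continuous fun p : E => amplitude (argument p) := by
  rw [continuous_iff_continuousAt]
  intro p
  set K₁ := ‖(memLp_const (1 : ℝ) : MemLp (fun _ => (1 : ℝ)) 2 unitMeasure).toLp _‖
  set K₂ := ‖(memLp_speed p).toLp _‖
  have hb : ∀ q : E, |amplitude (argument q) - amplitude (argument p)| ≤
      2 * (K₁ * ‖q.1 - p.1‖ + K₂ * ‖q.2 - p.2‖) := by
    intro q
    have h1 := amplitude_le_add (continuousOn_argument q) (continuousOn_argument p)
      fun t ht => abs_argument_sub_le p q ht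
    have h2 := amplitude_le_add (continuousOn_argument p) (continuousOn_argument q)
      fun t ht => (abs_sub_comm _ _).trans_le (abs_argument_sub_le p q ht)
    rw [abs_le]; constructor <;> linarith
  refine tendsto_iff_dist_tendsto_zero.mpr
    (squeeze_zero (fun _ => dist_nonneg) hb ?_)
  have hc : Continuous fun q : E => 2 * (K₁ * ‖q.1 - p.1‖ + K₂ * ‖q.2 - p.2‖) := by fun_prop
  simpa using hc.tendsto p

/-! ### Perturbing speed and angular velocity independently. -/

/-- For parameters in a compact set, small changes of the speed and of the derivative of the
argument change the parameters by little. -/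
lemma exists_forall_abs_h_sub_le (N : ℝ) {η : ℝ} (hη : 0 < η) :
    ∃ ρ > 0, ∀ x y u v : ℝ, |x| ≤ N → |y| ≤ N → |u| ≤ ρ → |v| ≤ ρ →
      0 < hInv x + u ∧ |(hInv x * hCurvInv y + v) / (hInv x + u)| < 1 ∧
      |h (hInv x + u) - x| ≤ η ∧
      |hCurv ((hInv x * hCurvInv y + v) / (hInv x + u)) - y| ≤ η := by
  have key : ∀ᶠ w : ℝ × ℝ in 𝓝 (0, 0), ∀ z ∈ Icc (-N) N ×ˢ Icc (-N) N,
      0 < hInv z.1 + w.1 ∧ |(hInv z.1 * hCurvInv z.2 + w.2) / (hInv z.1 + w.1)| < 1 ∧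
      |h (hInv z.1 + w.1) - z.1| < η ∧
      |hCurv ((hInv z.1 * hCurvInv z.2 + w.2) / (hInv z.1 + w.1)) - z.2| < η := by
    -- By compactness, joint continuity at perturbation `(0, 0)` suffices; there the expressions
    -- return `(x, y)` itself.
    refine IsCompact.eventually_forall_of_forall_eventually (isCompact_Icc.prod isCompact_Icc) ?_
    rintro ⟨x, y⟩ -
    have hx := hInv_pos x
    have hy := abs_lt.mp (abs_hCurvInv_lt_one y)
    have c1 : ContinuousAt (fun z : (ℝ × ℝ) × (ℝ × ℝ) => hInv z.2.1 + z.1.1) ((0, 0), (x, y)) :=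
      ((continuous_hInv.comp (by fun_prop : Continuous fun z : (ℝ × ℝ) × (ℝ × ℝ) => z.2.1)).add
        (by fun_prop)).continuousAt
    have e1 : hInv x + 0 ≠ 0 := by linarith
    have c2 : ContinuousAt (fun z : (ℝ × ℝ) × (ℝ × ℝ) =>
        (hInv z.2.1 * hCurvInv z.2.2 + z.1.2) / (hInv z.2.1 + z.1.1)) ((0, 0), (x, y)) := by
      refine ContinuousAt.div (Continuous.continuousAt ?_) c1 e1
      exact ((continuous_hInv.comp (by fun_prop)).mul (continuous_hCurvInv.comp
        (by fun_prop))).add (by fun_prop)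
    have e2 : (hInv x * hCurvInv y + 0) / (hInv x + 0) = hCurvInv y := by
      rw [add_zero, add_zero, mul_div_cancel_left₀ _ hx.ne']
    have c3 : ContinuousAt (fun z : (ℝ × ℝ) × (ℝ × ℝ) =>
        |h (hInv z.2.1 + z.1.1) - z.2.1|) ((0, 0), (x, y)) := by
      unfold h
      exact ((c1.sub (c1.inv₀ e1)).sub (by fun_prop)).abs
    have c4 : ContinuousAt (fun z : (ℝ × ℝ) × (ℝ × ℝ) =>
        |hCurv ((hInv z.2.1 * hCurvInv z.2.2 + z.1.2) / (hInv z.2.1 + z.1.1)) - z.2.2|)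
        ((0, 0), (x, y)) := by
      unfold hCurv
      refine (((continuousAt_const.sub c2).inv₀ ?_).add
        ((continuousAt_const.sub c2).inv₀ ?_)).sub (by fun_prop) |>.abs
      · change -1 - (hInv x * hCurvInv y + 0) / (hInv x + 0) ≠ 0
        rw [e2]; linarith
      · change 1 - (hInv x * hCurvInv y + 0) / (hInv x + 0) ≠ 0
        rw [e2]; linarith
    refine (c1.eventually_const_lt (by simpa using hx)).and
      ((c2.abs.eventually_lt_const ?_).and ((c3.eventually_lt_const ?_).and
        (c4.eventually_lt_const ?_)))
    · simp only [e2]; exact abs_hCurvInv_lt_one y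
    · simp only [add_zero, h_hInv, sub_self, abs_zero, hη]
    · simp only [e2, hCurv_hCurvInv, sub_self, abs_zero, hη]
  obtain ⟨ρ, hρ, H⟩ := Metric.eventually_nhds_iff.mp key
  refine ⟨ρ / 2, by positivity, fun x y u v hx hy hu hv => ?_⟩
  have := H (y := (u, v)) (by
    rw [Prod.dist_eq, max_lt_iff, Real.dist_eq, Real.dist_eq]
    constructor <;> simp only [sub_zero] <;> linarith) (x, y) ⟨abs_le.mp hx, abs_le.mp hy⟩
  exact ⟨this.1, this.2.1, this.2.2.1.le, this.2.2.2.le⟩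

/-- The set of times at which both parameters are bounded by `N`. -/
def boundedSet (p : E) (N : ℝ) : Set ℝ := {t | |p.1 t| ≤ N ∧ |p.2 t| ≤ N}

lemma measurable_fst (p : E) : Measurable (p.1 : ℝ → ℝ) := (Lp.stronglyMeasurable p.1).measurable

lemma measurable_snd (p : E) : Measurable (p.2 : ℝ → ℝ) := (Lp.stronglyMeasurable p.2).measurable

lemma measurable_speed (p : E) : Measurable (speed p) :=
  continuous_hInv.measurable.comp (measurable_fst p)

lemma measurable_curvature (p : E) : Measurable (curvature p) :=
  continuous_hCurvInv.measurable.comp (measurable_snd p)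

lemma measurableSet_boundedSet (p : E) (N : ℝ) : MeasurableSet (boundedSet p N) :=
  (measurableSet_le (measurable_fst p).abs measurable_const).inter
    (measurableSet_le (measurable_snd p).abs measurable_const)

lemma boundedSet_mono (p : E) : Monotone (boundedSet p) :=
  fun _ _ hMN _ ht => ⟨ht.1.trans hMN, ht.2.trans hMN⟩

lemma iUnion_boundedSet (p : E) : ⋃ n : ℕ, boundedSet p n = univ := by
  refine eq_univ_of_forall fun t => mem_iUnion.mpr ?_
  obtain ⟨n, hn⟩ := exists_nat_ge (max |p.1 t| |p.2 t|)
  exact ⟨n, (le_max_left _ _).trans hn, (le_max_right _ _).trans hn⟩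

/-- The bounded sets exhaust the line, so they cannot all meet `S` in a null set. -/
lemma eventually_measure_boundedSet_inter_pos (p : E) {S : Set ℝ} (hS : 0 < unitMeasure S) :
    ∀ᶠ n : ℕ in atTop, 0 < unitMeasure (boundedSet p n ∩ S) := by
  obtain ⟨n, hn⟩ : ∃ n : ℕ, 0 < unitMeasure (boundedSet p n ∩ S) := by
    by_contra! hc
    refine hS.ne' ?_
    have := measure_iUnion_null fun n => nonpos_iff_eq_zero.mp (hc n)
    rwa [← iUnion_inter, iUnion_boundedSet, univ_inter] at this
  filter_upwards [eventually_ge_atTop n] with m hm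
  exact hn.trans_le (measure_mono (inter_subset_inter_left _
    (boundedSet_mono p (by exact_mod_cast hm))))

lemma norm_toLp_sub_le {f : ℝ → ℝ} (hf : MemLp f 2 unitMeasure) (g : Lp ℝ 2 unitMeasure) {η : ℝ}
    (hη : 0 ≤ η) (hfg : ∀ t, |f t - g t| ≤ η) : ‖hf.toLp f - g‖ ≤ η := by
  have := Lp.norm_le_of_ae_bound (f := hf.toLp f - g) hη (by
    filter_upwards [Lp.coeFn_sub (hf.toLp f) g, hf.coeFn_toLp] with t h1 h2
    rw [h1, Pi.sub_apply, h2]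
    exact hfg t)
  simpa [measureUnivNNReal] using this

lemma memLp_of_abs_sub_le {f : ℝ → ℝ} (hf : Measurable f) (g : Lp ℝ 2 unitMeasure) {η : ℝ}
    (hfg : ∀ t, |f t - g t| ≤ η) : MemLp f 2 unitMeasure := by
  have h1 : MemLp (fun t => f t - g t) 2 unitMeasure :=
    MemLp.of_bound (hf.aestronglyMeasurable.sub (Lp.memLp g).1) η (.of_forall hfg)
  refine (memLp_congr_ae (.of_forall fun t => ?_)).mp (h1.add (Lp.memLp g))
  simp

/-- Small bounded changes of the speed and of the derivative of the argument, supported where the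
parameters are bounded, are realized by nearby parameters. -/
lemma exists_near_of_perturbation (p : E) (N : ℝ) {η : ℝ} (hη : 0 < η) :
    ∃ ρ > 0, ∀ u v : ℝ → ℝ, Measurable u → Measurable v → (∀ t, |u t| ≤ ρ) → (∀ t, |v t| ≤ ρ) →
      (∀ t ∉ boundedSet p N, u t = 0 ∧ v t = 0) →
      ∃ q : E, dist q p ≤ η ∧ (∀ᵐ t ∂unitMeasure, speed q t = speed p t + u t) ∧
        ∀ᵐ t ∂unitMeasure, speed q t * curvature q t = speed p t * curvature p t + v t := by
  obtain ⟨ρ, hρ, H⟩ := exists_forall_abs_h_sub_le N hη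
  refine ⟨ρ, hρ, fun u v hum hvm hu hv huv => ?_⟩
  have H' : ∀ t, 0 < speed p t + u t ∧
      |(speed p t * curvature p t + v t) / (speed p t + u t)| < 1 ∧
      |h (speed p t + u t) - p.1 t| ≤ η ∧
      |hCurv ((speed p t * curvature p t + v t) / (speed p t + u t)) - p.2 t| ≤ η := by
    intro t
    by_cases ht : t ∈ boundedSet p N
    · exact H (p.1 t) (p.2 t) (u t) (v t) ht.1 ht.2 (hu t) (hv t)
    -- Off the bounded set nothing is changed, so the parameters are recovered exactly.
    · have hs := speed_pos p t
      simp only [(huv t ht).1, (huv t ht).2, add_zero, mul_div_cancel_left₀ _ hs.ne']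
      refine ⟨hs, abs_curvature_lt_one p t, ?_, ?_⟩
      · simp only [speed, h_hInv, sub_self, abs_zero, hη.le]
      · simp only [curvature, hCurv_hCurvInv, sub_self, abs_zero, hη.le]
  have hsm : Measurable fun t => speed p t + u t := (measurable_speed p).add hum
  have hcm : Measurable fun t => (speed p t * curvature p t + v t) / (speed p t + u t) :=
    (((measurable_speed p).mul (measurable_curvature p)).add hvm).div hsm
  have hf₁ : Measurable fun t => h (speed p t + u t) := by
    unfold h; exact hsm.sub hsm.inv
  have hf₂ : Measurable fun t =>
      hCurv ((speed p t * curvature p t + v t) / (speed p t + u t)) := by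
    unfold hCurv; exact ((hcm.const_sub _).inv).add (hcm.const_sub _).inv
  have m₁ := memLp_of_abs_sub_le hf₁ p.1 fun t => (H' t).2.2.1
  have m₂ := memLp_of_abs_sub_le hf₂ p.2 fun t => (H' t).2.2.2
  have hs : ∀ᵐ t ∂unitMeasure, speed (m₁.toLp _, m₂.toLp _) t = speed p t + u t := by
    filter_upwards [m₁.coeFn_toLp] with t h1
    simp only [speed] at h1 ⊢
    rw [h1]
    exact hInv_h (H' t).1
  refine ⟨(m₁.toLp _, m₂.toLp _), ?_, hs, ?_⟩
  · rw [Prod.dist_eq, dist_eq_norm, dist_eq_norm]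
    exact max_le (norm_toLp_sub_le m₁ _ hη.le fun t => (H' t).2.2.1)
      (norm_toLp_sub_le m₂ _ hη.le fun t => (H' t).2.2.2)
  · filter_upwards [hs, m₂.coeFn_toLp] with t h1 h2
    have h3 : curvature (m₁.toLp _, m₂.toLp _) t
        = (speed p t * curvature p t + v t) / (speed p t + u t) := by
      rw [curvature, h2]
      exact hCurvInv_hCurv (abs_lt.mp (H' t).2.1)
    rw [h1, h3, mul_div_cancel₀ _ (H' t).1.ne']

/-! ### Restoring the final frame. -/

/-- The integral over `[0,1]` of `f exp (i α)`. -/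
def tangentIntegral (f α : ℝ → ℝ) : ℂ :=
  ∫ t, (f t : ℂ) * Complex.exp (α t * Complex.I) ∂unitMeasure

lemma curve_one (p : E) : curve p 1 = tangentIntegral (speed p) (argument p) := by
  simp only [curve, coe_tangent]
  rw [intervalIntegral_eq_integral_unitMeasure, tangentIntegral]

lemma aestronglyMeasurable_exp {α : ℝ → ℝ} (hα : AEStronglyMeasurable α unitMeasure) :
    AEStronglyMeasurable (fun t => Complex.exp (α t * Complex.I)) unitMeasure :=
  (by fun_prop : Continuous fun x : ℝ => Complex.exp (x * Complex.I)).comp_aestronglyMeasurable hα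

lemma integrable_mul_exp {f α : ℝ → ℝ} (hf : Integrable f unitMeasure)
    (hα : AEStronglyMeasurable α unitMeasure) :
    Integrable (fun t => (f t : ℂ) * Complex.exp (α t * Complex.I)) unitMeasure :=
  hf.ofReal.mul_bdd (c := 1) (aestronglyMeasurable_exp hα)
    (.of_forall fun _ => (Complex.norm_exp_ofReal_mul_I _).le)

lemma continuous_tangentIntegral {f α β : ℝ → ℝ} (hf : Integrable f unitMeasure)
    (hα : AEStronglyMeasurable α unitMeasure) (hβ : AEStronglyMeasurable β unitMeasure) :
    Continuous fun ε : ℝ => tangentIntegral f fun t => α t + ε * β t := by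
  refine continuous_of_dominated (bound := fun t => |f t|)
    (fun ε => (integrable_mul_exp hf (hα.add (hβ.const_mul ε))).1)
    (fun ε => .of_forall fun t => ?_) hf.abs (.of_forall fun t => by fun_prop)
  rw [norm_mul, Complex.norm_exp_ofReal_mul_I, mul_one, Complex.norm_real, Real.norm_eq_abs]

lemma tangentIntegral_add_add {f g k α : ℝ → ℝ} (hf : Integrable f unitMeasure)
    (hg : Integrable g unitMeasure) (hk : Integrable k unitMeasure)
    (hα : AEStronglyMeasurable α unitMeasure) (a b : ℝ) :
    tangentIntegral (fun t => f t + (a * g t + b * k t)) α =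
      tangentIntegral f α + (a * tangentIntegral g α + b * tangentIntegral k α) := by
  have i1 := integrable_mul_exp hf hα
  have i2 := (integrable_mul_exp hg hα).const_mul (a : ℂ)
  have i3 := (integrable_mul_exp hk hα).const_mul (b : ℂ)
  simp only [tangentIntegral]
  rw [← integral_const_mul, ← integral_const_mul, ← integral_add i2 i3]
  refine Eq.trans (integral_congr_ae (.of_forall fun t => ?_)) (integral_add i1 (i2.add i3))
  simp only
  push_cast; ring

lemma tangentIntegral_sub_const (f α : ℝ → ℝ) (β : ℝ) :
    tangentIntegral f (fun t => α t - β) =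
      tangentIntegral f α * Complex.exp (-(β * Complex.I)) := by
  simp only [tangentIntegral]
  rw [← integral_mul_const]
  refine integral_congr_ae (.of_forall fun t => ?_)
  simp only
  rw [mul_assoc, ← Complex.exp_add]
  push_cast; ring_nf

lemma re_tangentIntegral {f α : ℝ → ℝ} (hf : Integrable f unitMeasure)
    (hα : AEStronglyMeasurable α unitMeasure) :
    (tangentIntegral f α).re = ∫ t, f t * Real.cos (α t) ∂unitMeasure := by
  have := integral_re (integrable_mul_exp hf hα)
  simp only [RCLike.re_to_complex, Complex.re_ofReal_mul, Complex.exp_ofReal_mul_I_re] at this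
  exact this.symm

lemma im_tangentIntegral {f α : ℝ → ℝ} (hf : Integrable f unitMeasure)
    (hα : AEStronglyMeasurable α unitMeasure) :
    (tangentIntegral f α).im = ∫ t, f t * Real.sin (α t) ∂unitMeasure := by
  have := integral_im (integrable_mul_exp hf hα)
  simp only [RCLike.im_to_complex, Complex.im_ofReal_mul, Complex.exp_ofReal_mul_I_im] at this
  exact this.symm

lemma integral_indicator_one_mul_pos {B : Set ℝ} (hB : MeasurableSet B)
    (hpos : 0 < unitMeasure B) {f : ℝ → ℝ} (hf : Integrable f unitMeasure)
    (hfB : ∀ t ∈ B, 0 < f t) : 0 < ∫ t, B.indicator 1 t * f t ∂unitMeasure := by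
  have e : (fun t => B.indicator 1 t * f t) = B.indicator f := by
    ext t; by_cases ht : t ∈ B <;> simp [ht]
  rw [e, integral_pos_iff_support_of_nonneg_ae
    (.of_forall fun t => indicator_nonneg (fun t ht => (hfB t ht).le) t) (hf.indicator hB)]
  refine hpos.trans_le (measure_mono fun t ht => ?_)
  simpa [ht] using (hfB t ht).ne'

/-- The mean velocities over a set of times where the tangent points to one side of the direction
`β` and over a set where it points to the other side are linearly independent. -/
lemma im_tangentIntegral_mul_conj_pos {α : ℝ → ℝ} (hα : AEStronglyMeasurable α unitMeasure)
    {β : ℝ} {B₁ B₂ : Set ℝ} (hB₁ : MeasurableSet B₁) (hB₂ : MeasurableSet B₂)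
    (h₁ : 0 < unitMeasure B₁) (h₂ : 0 < unitMeasure B₂)
    (hα₁ : ∀ t ∈ B₁, α t ∈ Ioo β (β + Real.pi / 2))
    (hα₂ : ∀ t ∈ B₂, α t ∈ Ioo (β - Real.pi / 2) β) :
    0 < (tangentIntegral (B₁.indicator 1) α *
      (starRingEnd ℂ) (tangentIntegral (B₂.indicator 1) α)).im := by
  have hα' : AEStronglyMeasurable (fun t => α t - β) unitMeasure :=
    hα.sub aestronglyMeasurable_const
  have icos : Integrable (fun t => Real.cos (α t - β)) unitMeasure :=
    .of_bound (Real.continuous_cos.comp_aestronglyMeasurable hα') 1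
      (.of_forall fun t => Real.abs_cos_le_one _)
  have isin : Integrable (fun t => Real.sin (α t - β)) unitMeasure :=
    .of_bound (Real.continuous_sin.comp_aestronglyMeasurable hα') 1
      (.of_forall fun t => Real.abs_sin_le_one _)
  have ib : ∀ {B : Set ℝ}, MeasurableSet B → Integrable (B.indicator (1 : ℝ → ℝ)) unitMeasure :=
    fun hB => (integrable_const (1 : ℝ)).indicator hB
  have r₁ : 0 < (tangentIntegral (B₁.indicator 1) fun t => α t - β).re := by
    rw [re_tangentIntegral (ib hB₁) hα']
    exact integral_indicator_one_mul_pos hB₁ h₁ icos fun t ht =>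
      Real.cos_pos_of_mem_Ioo ⟨by linarith [(hα₁ t ht).1, Real.pi_pos],
        by linarith [(hα₁ t ht).2]⟩
  have r₂ : 0 < (tangentIntegral (B₂.indicator 1) fun t => α t - β).re := by
    rw [re_tangentIntegral (ib hB₂) hα']
    exact integral_indicator_one_mul_pos hB₂ h₂ icos fun t ht =>
      Real.cos_pos_of_mem_Ioo ⟨by linarith [(hα₂ t ht).1],
        by linarith [(hα₂ t ht).2, Real.pi_pos]⟩
  have s₁ : 0 < (tangentIntegral (B₁.indicator 1) fun t => α t - β).im := by
    rw [im_tangentIntegral (ib hB₁) hα']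
    exact integral_indicator_one_mul_pos hB₁ h₁ isin fun t ht =>
      Real.sin_pos_of_pos_of_lt_pi (by linarith [(hα₁ t ht).1])
        (by linarith [(hα₁ t ht).2, Real.pi_pos])
  have s₂ : (tangentIntegral (B₂.indicator 1) fun t => α t - β).im < 0 := by
    rw [im_tangentIntegral (ib hB₂) hα', ← neg_pos, ← integral_neg]
    simp only [← mul_neg]
    exact integral_indicator_one_mul_pos hB₂ h₂ isin.neg fun t ht => neg_pos.mpr <|
      Real.sin_neg_of_neg_of_neg_pi_lt (by linarith [(hα₂ t ht).2])
        (by linarith [(hα₂ t ht).1, Real.pi_pos])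
  -- Rotating both vectors by `-β` preserves the determinant and puts them in the open first and
  -- fourth quadrants.
  have e : tangentIntegral (B₁.indicator 1) α *
      (starRingEnd ℂ) (tangentIntegral (B₂.indicator 1) α) =
      tangentIntegral (B₁.indicator 1) (fun t => α t - β) *
      (starRingEnd ℂ) (tangentIntegral (B₂.indicator 1) fun t => α t - β) := by
    have : Complex.exp (-(β * Complex.I)) * (starRingEnd ℂ) (Complex.exp (-(β * Complex.I)))
        = 1 := by
      rw [← Complex.exp_conj, ← Complex.exp_add]; simp
    rw [tangentIntegral_sub_const, tangentIntegral_sub_const, map_mul]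
    linear_combination (-(tangentIntegral (B₁.indicator 1) α *
      (starRingEnd ℂ) (tangentIntegral (B₂.indicator 1) α))) * this
  rw [e, Complex.mul_im, Complex.conj_re, Complex.conj_im]
  nlinarith [mul_pos s₁ r₂, mul_pos r₁ (neg_pos.mpr s₂)]

/-- Cramer's rule for a real basis of `ℂ`. -/
lemma cramer_complex {c₁ c₂ : ℂ} (hc : (c₁ * (starRingEnd ℂ) c₂).im ≠ 0) (d : ℂ) :
    (((d * (starRingEnd ℂ) c₂).im / (c₁ * (starRingEnd ℂ) c₂).im : ℝ) : ℂ) * c₁ +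
      (((c₁ * (starRingEnd ℂ) d).im / (c₁ * (starRingEnd ℂ) c₂).im : ℝ) : ℂ) * c₂ = d := by
  apply Complex.ext <;>
  · simp only [Complex.add_re, Complex.add_im, Complex.re_ofReal_mul, Complex.im_ofReal_mul]
    rw [div_mul_eq_mul_div, div_mul_eq_mul_div, ← add_div, div_eq_iff hc]
    simp only [Complex.mul_im, Complex.conj_re, Complex.conj_im]
    ring

lemma measurableSet_Ioo_inter_preimage {f : ℝ → ℝ} (hf : ContinuousOn f (Icc 0 1)) (a b : ℝ) :
    MeasurableSet (Ioo 0 1 ∩ f ⁻¹' Ioo a b) :=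
  ((hf.mono Ioo_subset_Icc_self).isOpen_inter_preimage isOpen_Ioo isOpen_Ioo).measurableSet

/-- The value `(a + b) / 2` is attained between `s` and `t` and at neither of them, hence in the
open interval; so the preimage is open and nonempty. -/
lemma unitMeasure_Ioo_inter_preimage_pos {f : ℝ → ℝ} (hf : ContinuousOn f (Icc 0 1)) {s t a b : ℝ}
    (hs : s ∈ Icc (0 : ℝ) 1) (ht : t ∈ Icc (0 : ℝ) 1) (hsa : f s ≤ a) (hab : a < b)
    (hbt : b ≤ f t) : 0 < unitMeasure (Ioo 0 1 ∩ f ⁻¹' Ioo a b) := by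
  have hopen := (hf.mono Ioo_subset_Icc_self).isOpen_inter_preimage isOpen_Ioo
    (isOpen_Ioo (a := a) (b := b))
  have hsub : uIcc s t ⊆ Icc 0 1 := uIcc_subset_Icc hs ht
  obtain ⟨x, hx, hfx⟩ := intermediate_value_uIcc (hf.mono hsub)
    (show (a + b) / 2 ∈ uIcc (f s) (f t) by
      rw [uIcc_of_le (by linarith)]; constructor <;> linarith)
  have hx01 := hsub hx
  have hxs : x ≠ s := by rintro rfl; linarith
  have hxt : x ≠ t := by rintro rfl; linarith
  have hx0 : x ≠ 0 := by
    rintro rfl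
    rcases min_le_iff.mp hx.1 with h | h
    · exact hxs (le_antisymm hs.1 h)
    · exact hxt (le_antisymm ht.1 h)
  have hx1 : x ≠ 1 := by
    rintro rfl
    rcases le_max_iff.mp hx.2 with h | h
    · exact hxs (le_antisymm h hs.2)
    · exact hxt (le_antisymm h ht.2)
  rw [unitMeasure, Measure.restrict_apply hopen.measurableSet,
    inter_eq_left.mpr (inter_subset_left.trans Ioo_subset_Icc_self)]
  refine hopen.measure_pos volume ⟨x, ⟨lt_of_le_of_ne hx01.1 hx0.symm, lt_of_le_of_ne hx01.2 hx1⟩, ?_⟩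
  rw [mem_preimage, hfx]
  constructor <;> linarith

lemma argument_eq_add {p q : E} {v : ℝ → ℝ} (hv : Integrable v unitMeasure)
    (h : ∀ᵐ t ∂unitMeasure, speed q t * curvature q t = speed p t * curvature p t + v t) {t : ℝ}
    (ht : t ∈ Icc (0 : ℝ) 1) : argument q t = argument p t + ∫ s in (0 : ℝ)..t, v s := by
  have hsub := uIcc_zero_subset ht
  unfold argument
  rw [← intervalIntegral.integral_add ((intervalIntegrable_speed_mul_curvature p).mono_set hsub)
    ((intervalIntegrable_iff_integrable_unitMeasure.mpr hv).mono_set hsub)]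
  refine intervalIntegral.integral_congr_ae ?_
  filter_upwards [(ae_restrict_iff' measurableSet_Icc).mp h] with s hs hst
  rw [uIoc_of_le ht.1] at hst
  exact hs ⟨hst.1.le, hst.2.trans ht.2⟩

/-- If the amplitude of a curve is `π`, then the derivative of its argument may be changed by any
small multiple of a bounded function of mean zero supported where the parameters are bounded, and
the speed can be corrected so that the final frame is kept. -/
lemma eventually_exists_mem_curveSpace {Q : ℂ × Circle} {θ₁ : ℝ} {p : E}
    (hp : p ∈ curveSpace Q θ₁) (hcrit : amplitude (argument p) = Real.pi) {n : ℕ} {g : ℝ → ℝ}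
    (hg : Measurable g) {C : ℝ} (hgC : ∀ t, |g t| ≤ C) (hg0 : ∀ t ∉ boundedSet p n, g t = 0)
    (hgint : ∫ t in (0 : ℝ)..1, g t = 0) {η : ℝ} (hη : 0 < η) :
    ∀ᶠ ε : ℝ in 𝓝 0, ∃ q ∈ curveSpace Q θ₁, dist q p ≤ η ∧
      ∀ t ∈ Icc (0 : ℝ) 1, argument q t = argument p t + ε * ∫ s in (0 : ℝ)..t, g s := by
  have hcont := continuousOn_argument p
  have hα : AEStronglyMeasurable (argument p) unitMeasure :=
    hcont.aestronglyMeasurable measurableSet_Icc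
  have hgi : Integrable g unitMeasure := .of_bound hg.aestronglyMeasurable C (.of_forall hgC)
  set ψ : ℝ → ℝ := fun t => ∫ s in (0 : ℝ)..t, g s with hψ
  have hβ : AEStronglyMeasurable ψ unitMeasure := by
    have := ((intervalIntegrable_iff_integrable_unitMeasure.mpr
      hgi).absolutelyContinuousOnInterval_intervalIntegral (c := 0) (by simp)).continuousOn
    rw [uIcc_of_le zero_le_one] at this
    exact this.aestronglyMeasurable measurableSet_Icc
  obtain ⟨s, hs, t, ht, -, hst⟩ := exists_amplitude_eq hcont
  rw [hcrit] at hst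
  -- The middle of the range of the argument, which is `[β - π/2, β + π/2]`.
  set β := argument p s + Real.pi / 2 with hβ'
  have hpi := Real.pi_pos
  have P₁ := unitMeasure_Ioo_inter_preimage_pos hcont hs ht (a := β) (b := β + Real.pi / 2)
    (by linarith) (by linarith) (by linarith)
  have P₂ := unitMeasure_Ioo_inter_preimage_pos hcont hs ht (a := β - Real.pi / 2) (b := β)
    (by linarith) (by linarith) (by linarith)
  obtain ⟨N, hN₁, hN₂, hnN⟩ := ((eventually_measure_boundedSet_inter_pos p P₁).and
    ((eventually_measure_boundedSet_inter_pos p P₂).and (eventually_ge_atTop n))).exists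
  set B₁ := boundedSet p N ∩ (Ioo 0 1 ∩ argument p ⁻¹' Ioo β (β + Real.pi / 2)) with hB₁
  set B₂ := boundedSet p N ∩ (Ioo 0 1 ∩ argument p ⁻¹' Ioo (β - Real.pi / 2) β) with hB₂
  have mB₁ : MeasurableSet B₁ :=
    (measurableSet_boundedSet p N).inter (measurableSet_Ioo_inter_preimage hcont _ _)
  have mB₂ : MeasurableSet B₂ :=
    (measurableSet_boundedSet p N).inter (measurableSet_Ioo_inter_preimage hcont _ _)
  have ib : ∀ {B : Set ℝ}, MeasurableSet B → Integrable (B.indicator (1 : ℝ → ℝ)) unitMeasure :=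
    fun hB => (integrable_const (1 : ℝ)).indicator hB
  have hD := im_tangentIntegral_mul_conj_pos hα mB₁ mB₂ hN₁ hN₂ (fun t ht => ht.2.2)
    (fun t ht => ht.2.2)
  have hsp : Integrable (speed p) unitMeasure :=
    intervalIntegrable_iff_integrable_unitMeasure.mp (intervalIntegrable_speed p)
  set c₁ : ℝ → ℂ := fun ε => tangentIntegral (B₁.indicator 1) fun t => argument p t + ε * ψ t
  set c₂ : ℝ → ℂ := fun ε => tangentIntegral (B₂.indicator 1) fun t => argument p t + ε * ψ t
  -- The end point defect caused by the new argument. The coefficients `a`, `b` below solve `a c₁ +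
  -- b c₂ = d`; they are continuous at `0` and vanish there because `d 0 = 0`, so the correction of
  -- the speed is small.
  set d : ℝ → ℂ := fun ε => curve p 1 - tangentIntegral (speed p)
    fun t => argument p t + ε * ψ t with hd
  have hc₁ : Continuous c₁ := continuous_tangentIntegral (ib mB₁) hα hβ
  have hc₂ : Continuous c₂ := continuous_tangentIntegral (ib mB₂) hα hβ
  have hdc : Continuous d := continuous_const.sub (continuous_tangentIntegral hsp hα hβ)
  have hd0 : d 0 = 0 := by simp [hd, curve_one]
  set D : ℝ → ℝ := fun ε => (c₁ ε * (starRingEnd ℂ) (c₂ ε)).im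
  have hDc : Continuous D :=
    Complex.continuous_im.comp (hc₁.mul (Complex.continuous_conj.comp hc₂))
  have hD0 : 0 < D 0 := by simpa [D, c₁, c₂] using hD
  set a : ℝ → ℝ := fun ε => (d ε * (starRingEnd ℂ) (c₂ ε)).im / D ε with ha
  set b : ℝ → ℝ := fun ε => (c₁ ε * (starRingEnd ℂ) (d ε)).im / D ε with hb
  have hac : ContinuousAt a 0 := (Complex.continuous_im.comp
    (hdc.mul (Complex.continuous_conj.comp hc₂))).continuousAt.div hDc.continuousAt hD0.ne'
  have hbc : ContinuousAt b 0 := (Complex.continuous_im.comp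
    (hc₁.mul (Complex.continuous_conj.comp hdc))).continuousAt.div hDc.continuousAt hD0.ne'
  have ha0 : a 0 = 0 := by simp [ha, hd0]
  have hb0 : b 0 = 0 := by simp [hb, hd0]
  obtain ⟨ρ, hρ, H⟩ := exists_near_of_perturbation p N hη
  have hC : Continuous fun ε : ℝ => |ε| * C := by fun_prop
  filter_upwards [hDc.continuousAt.eventually_const_lt hD0,
    (hac.abs.add hbc.abs).eventually_lt_const (show |a 0| + |b 0| < ρ by simpa [ha0, hb0] using hρ),
    hC.continuousAt.eventually_lt_const (show |(0 : ℝ)| * C < ρ by simpa using hρ)]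
    with ε hDε habε hCε
  have hind : ∀ (B : Set ℝ) t, |B.indicator (1 : ℝ → ℝ) t| ≤ 1 := fun B t => by
    by_cases h : t ∈ B <;> simp [h]
  -- Only `σκ` sees `g`, and only `σ` sees the correction, so the argument does not depend on `a`
  -- and `b`.
  obtain ⟨q, hqp, hqs, hqv⟩ := H
    (fun t => a ε * B₁.indicator 1 t + b ε * B₂.indicator 1 t) (fun t => ε * g t)
    (((measurable_one.indicator mB₁).const_mul _).add ((measurable_one.indicator mB₂).const_mul _))
    (hg.const_mul _)
    (fun t => by
      refine (abs_add_le _ _).trans (le_trans ?_ habε.le)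
      rw [abs_mul, abs_mul]
      exact add_le_add (mul_le_of_le_one_right (abs_nonneg _) (hind _ _))
        (mul_le_of_le_one_right (abs_nonneg _) (hind _ _)))
    (fun t => by
      rw [abs_mul]
      exact (mul_le_mul_of_nonneg_left (hgC t) (abs_nonneg _)).trans hCε.le)
    (fun t ht => by
      have h₁ : t ∉ B₁ := fun h => ht h.1
      have h₂ : t ∉ B₂ := fun h => ht h.1
      have h₃ : t ∉ boundedSet p n := fun h => ht (boundedSet_mono p (by exact_mod_cast hnN) h)
      simp [h₁, h₂, hg0 t h₃])
  have harg : ∀ t ∈ Icc (0 : ℝ) 1, argument q t = argument p t + ε * ψ t := fun t ht => by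
    rw [argument_eq_add (hgi.const_mul ε) hqv ht, intervalIntegral.integral_const_mul]
  have harg1 : argument q 1 = argument p 1 := by
    rw [harg 1 (by simp)]; simp only [hψ, hgint, mul_zero, add_zero]
  have hcurve : curve q 1 = curve p 1 := by
    have e1 : curve q 1 = tangentIntegral (fun t => speed p t +
        (a ε * B₁.indicator 1 t + b ε * B₂.indicator 1 t)) fun t => argument p t + ε * ψ t := by
      rw [curve_one]
      refine integral_congr_ae ?_
      filter_upwards [hqs, ae_restrict_mem measurableSet_Icc] with t h1 h2
      rw [h1, harg t h2]
    rw [e1, tangentIntegral_add_add (α := fun t => argument p t + ε * ψ t) hsp (ib mB₁) (ib mB₂)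
      (hα.add (hβ.const_mul ε))]
    have := cramer_complex hDε.ne' (d ε)
    change (a ε : ℂ) * c₁ ε + b ε * c₂ ε = d ε at this
    change _ + ((a ε : ℂ) * c₁ ε + b ε * c₂ ε) = _
    rw [this]
    simp [hd]
  refine ⟨q, ⟨?_, ?_⟩, hqp, harg⟩
  · rw [← hp.1]; simp only [frame, tangent, hcurve, harg1]
  · rw [← hp.2]; simp only [totalTurning, harg1, argument_zero]

/-! ### Mean-zero directions supported where the parameters are bounded. -/

lemma measureReal_boundedSet_inter_pos {p : E} {n : ℕ} {S : Set ℝ}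
    (h : 0 < unitMeasure (boundedSet p n ∩ S)) : 0 < unitMeasure.real (boundedSet p n ∩ S) :=
  ENNReal.toReal_pos h.ne' (measure_ne_top _ _)

/-- An integrable function of mean zero is approximated in `L¹` by functions of mean zero which
are supported on a set of times with bounded parameters and bounded if the given function is
bounded there. -/
lemma exists_boundedSet_indicator_near (p : E) {f : ℝ → ℝ} (hf : Integrable f unitMeasure)
    (hf0 : ∫ t, f t ∂unitMeasure = 0) {η : ℝ} (hη : 0 < η) :
    ∃ (n : ℕ) (r : ℝ), ∫ t, (boundedSet p n).indicator (fun t => f t - r) t ∂unitMeasure = 0 ∧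
      ∫ t, |(boundedSet p n).indicator (fun t => f t - r) t - f t| ∂unitMeasure < η := by
  have hm := measurableSet_boundedSet p
  have hlim : Tendsto (fun n : ℕ => ∫ t in (boundedSet p n)ᶜ, |f t| ∂unitMeasure) atTop (𝓝 0) := by
    have := tendsto_setIntegral_of_antitone (μ := unitMeasure) (f := fun t => |f t|)
      (s := fun n : ℕ => (boundedSet p n)ᶜ) (fun n => (hm n).compl)
      (fun m n hmn => compl_subset_compl.mpr (boundedSet_mono p (by exact_mod_cast hmn)))
      ⟨0, hf.abs.integrableOn⟩
    rwa [← compl_iUnion, iUnion_boundedSet, compl_univ, Measure.restrict_empty,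
      integral_zero_measure] at this
  obtain ⟨n, hn, hnpos⟩ := ((hlim.eventually_lt_const (half_pos hη)).and
    (eventually_measure_boundedSet_inter_pos p (S := univ) (by simp))).exists
  have hpos := measureReal_boundedSet_inter_pos hnpos
  rw [inter_univ] at hpos
  set A := boundedSet p n
  have hA : MeasurableSet A := hm n
  -- The mean of `f` over `A`. Since `f` has mean zero, subtracting `r` costs no more in `L¹` than
  -- cutting off `f` outside `A`.
  set r := (∫ t in A, f t ∂unitMeasure) / unitMeasure.real A with hr
  have hrA : unitMeasure.real A * r = ∫ t in A, f t ∂unitMeasure := by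
    rw [hr]; field_simp
  refine ⟨n, r, ?_, ?_⟩
  · rw [integral_indicator hA, integral_sub hf.integrableOn (integrable_const r).integrableOn,
      setIntegral_const, smul_eq_mul, hrA, sub_self]
  · have hsplit := integral_add_compl hA hf
    rw [hf0] at hsplit
    have e : (fun t => |A.indicator (fun t => f t - r) t - f t|) =
        fun t => Aᶜ.indicator (fun t => |f t|) t + A.indicator (fun _ => |r|) t := by
      ext t
      by_cases ht : t ∈ A <;> simp [ht]
    rw [e, integral_add (hf.abs.indicator hA.compl) ((integrable_const _).indicator hA),
      integral_indicator hA.compl, integral_indicator hA, setIntegral_const, smul_eq_mul]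
    have h1 : unitMeasure.real A * |r| = |∫ t in A, f t ∂unitMeasure| := by
      rw [← hrA, abs_mul, abs_of_pos hpos]
    have h2 : |∫ t in A, f t ∂unitMeasure| ≤ ∫ t in Aᶜ, |f t| ∂unitMeasure := by
      rw [show ∫ t in A, f t ∂unitMeasure = -∫ t in Aᶜ, f t ∂unitMeasure by linarith, abs_neg]
      exact abs_integral_le_integral_abs
    linarith

/-- For `s < t` in `[0,1]`, not both end points, some bounded function of mean zero supported where
the parameters are bounded has integral `1` over `[s,t]`. -/
lemma exists_bounded_intervalIntegral_sub_eq_one (p : E) {s t : ℝ} (hs : s ∈ Icc (0 : ℝ) 1)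
    (ht : t ∈ Icc (0 : ℝ) 1) (hst : s < t) (hne : t - s < 1) :
    ∃ (n : ℕ) (g : ℝ → ℝ) (C : ℝ), Measurable g ∧ (∀ x, |g x| ≤ C) ∧
      (∀ x ∉ boundedSet p n, g x = 0) ∧ ∫ x in (0 : ℝ)..1, g x = 0 ∧
      (∫ x in (0 : ℝ)..t, g x) - ∫ x in (0 : ℝ)..s, g x = 1 := by
  have hJ : Ioc s t ⊆ Icc 0 1 := fun x hx => ⟨hs.1.trans hx.1.le, hx.2.trans ht.2⟩
  have hμJ : unitMeasure (Ioc s t) = ENNReal.ofReal (t - s) := by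
    rw [unitMeasure, Measure.restrict_apply measurableSet_Ioc, inter_eq_left.mpr hJ,
      Real.volume_Ioc]
  have P₁ : 0 < unitMeasure (Ioc s t) := by rw [hμJ]; simpa using hst
  have P₂ : 0 < unitMeasure (Ioc s t)ᶜ := by
    rw [measure_compl measurableSet_Ioc (measure_ne_top _ _), hμJ, measure_univ, tsub_pos_iff_lt,
      ENNReal.ofReal_lt_one]
    exact hne
  obtain ⟨n, h₁, h₂⟩ := ((eventually_measure_boundedSet_inter_pos p P₁).and
    (eventually_measure_boundedSet_inter_pos p P₂)).exists
  replace h₁ := measureReal_boundedSet_inter_pos h₁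
  replace h₂ := measureReal_boundedSet_inter_pos h₂
  have m₁ := (measurableSet_boundedSet p n).inter (measurableSet_Ioc (a := s) (b := t))
  have m₂ := (measurableSet_boundedSet p n).inter (measurableSet_Ioc (a := s) (b := t)).compl
  set A₁ := boundedSet p n ∩ Ioc s t
  set A₂ := boundedSet p n ∩ (Ioc s t)ᶜ
  -- Unit mass is placed inside `(s, t]` and removed outside it; `t - s < 1` leaves room outside.
  set k₁ := (unitMeasure.real A₁)⁻¹ with hk₁
  set k₂ := (unitMeasure.real A₂)⁻¹ with hk₂
  have i₁ : Integrable (A₁.indicator fun _ => k₁) unitMeasure :=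
    (integrable_const _).indicator m₁
  have i₂ : Integrable (A₂.indicator fun _ => k₂) unitMeasure :=
    (integrable_const _).indicator m₂
  have hg : IntervalIntegrable (fun x => A₁.indicator (fun _ => k₁) x -
      A₂.indicator (fun _ => k₂) x) volume 0 1 :=
    intervalIntegrable_iff_integrable_unitMeasure.mpr (i₁.sub i₂)
  refine ⟨n, fun x => A₁.indicator (fun _ => k₁) x - A₂.indicator (fun _ => k₂) x,
    |k₁| + |k₂|, (measurable_const.indicator m₁).sub (measurable_const.indicator m₂),
    fun x => ?_, fun x hx => ?_, ?_, ?_⟩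
  · refine (abs_sub _ _).trans (add_le_add ?_ ?_)
    · by_cases h : x ∈ A₁ <;> simp [h]
    · by_cases h : x ∈ A₂ <;> simp [h]
  · have h₁ : x ∉ A₁ := fun h => hx h.1
    have h₂ : x ∉ A₂ := fun h => hx h.1
    simp [h₁, h₂]
  · rw [intervalIntegral_eq_integral_unitMeasure, integral_sub i₁ i₂, integral_indicator m₁,
      integral_indicator m₂, setIntegral_const, setIntegral_const, smul_eq_mul, smul_eq_mul,
      hk₁, hk₂, mul_inv_cancel₀ h₁.ne', mul_inv_cancel₀ h₂.ne', sub_self]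
  · rw [intervalIntegral.integral_interval_sub_left (hg.mono_set (uIcc_zero_subset ht))
      (hg.mono_set (uIcc_zero_subset hs)), intervalIntegral.integral_of_le hst.le]
    have e : ∫ x in Ioc s t, (A₁.indicator (fun _ => k₁) x - A₂.indicator (fun _ => k₂) x) =
        ∫ x in Ioc s t, A₁.indicator (fun _ => k₁) x := by
      refine setIntegral_congr_fun measurableSet_Ioc fun x hx => ?_
      have : x ∉ A₂ := fun h => h.2 hx
      simp [this]
    have e' : volume.real (Ioc s t ∩ A₁) = unitMeasure.real A₁ := by
      rw [unitMeasure, measureReal_restrict_apply m₁,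
        inter_eq_right.mpr (inter_subset_right : A₁ ⊆ Ioc s t),
        inter_eq_left.mpr ((inter_subset_right : A₁ ⊆ Ioc s t).trans hJ)]
    rw [e, setIntegral_indicator m₁, setIntegral_const, smul_eq_mul, e', hk₁,
      mul_inv_cancel₀ h₁.ne']

/-! ### Critical curves as limits of condensed and of diffuse curves. -/

lemma critical_subset_closure_condensed {Q : ℂ × Circle} {θ₁ : ℝ} (hθ₁ : |θ₁| < Real.pi) :
    critical Q θ₁ ⊆ closure (condensed Q θ₁) := by
  rintro ⟨p, hp⟩ (hcrit : amplitude (argument p) = Real.pi)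
  rw [Metric.mem_closure_iff]
  intro η hη
  have hw := intervalIntegrable_speed_mul_curvature p
  have hw' := intervalIntegrable_iff_integrable_unitMeasure.mp hw
  have harg1 : argument p 1 = θ₁ := by
    have := hp.2
    rwa [totalTurning, argument_zero, sub_zero] at this
  -- The derivative of `θ₁ t - θ(t)`, almost everywhere.
  set f : ℝ → ℝ := fun t => θ₁ - speed p t * curvature p t with hf
  have hfi : Integrable f unitMeasure := (integrable_const _).sub hw'
  have hf0 : ∫ t, f t ∂unitMeasure = 0 := by
    rw [hf, integral_sub (integrable_const _) hw', ← intervalIntegral_eq_integral_unitMeasure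
      (fun t => speed p t * curvature p t)]
    change _ - argument p 1 = 0
    rw [harg1]; simp
  -- Half the gap, because an increment of `ψ` involves the error at two times.
  obtain ⟨n, r, hg0, hgf⟩ := exists_boundedSet_indicator_near p hfi hf0
    (show 0 < (Real.pi - |θ₁|) / 2 by linarith)
  set g := (boundedSet p n).indicator fun t => f t - r with hg
  have hgm : Measurable g := ((measurable_const.sub ((measurable_speed p).mul
    (measurable_curvature p))).sub measurable_const).indicator (measurableSet_boundedSet p n)
  have hgC : ∀ t, |g t| ≤ |θ₁| + (n + 1) + |r| := by
    intro t
    by_cases ht : t ∈ boundedSet p n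
    · rw [hg, indicator_of_mem ht]
      refine (abs_sub _ _).trans (add_le_add_left ((abs_sub _ _).trans (add_le_add_right ?_ _)) _)
      rw [abs_mul, abs_of_pos (speed_pos p t)]
      refine (mul_le_of_le_one_right (speed_pos p t).le (abs_curvature_lt_one p t).le).trans ?_
      exact (hInv_le _).trans (add_le_add_left ht.1 _)
    · rw [hg, indicator_of_notMem ht, abs_zero]; positivity
  have hgi : Integrable g unitMeasure :=
    .of_bound hgm.aestronglyMeasurable _ (.of_forall hgC)
  have hψ : ∀ t ∈ Icc (0 : ℝ) 1, |(∫ s in (0 : ℝ)..t, g s) - (θ₁ * t - argument p t)| <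
      (Real.pi - |θ₁|) / 2 := by
    intro t ht
    have hsub := uIcc_zero_subset ht
    have e : ∫ s in (0 : ℝ)..t, f s = θ₁ * t - argument p t := by
      rw [hf, intervalIntegral.integral_sub (by simp) (hw.mono_set hsub)]
      simp [argument, mul_comm]
    rw [← e, ← intervalIntegral.integral_sub
      ((intervalIntegrable_iff_integrable_unitMeasure.mpr hgi).mono_set hsub)
      ((intervalIntegrable_iff_integrable_unitMeasure.mpr hfi).mono_set hsub)]
    exact (abs_intervalIntegral_le_integral_abs (hgi.sub hfi) ht).trans_lt hgf
  obtain ⟨ε, ⟨q, hq, hqp, hqa⟩, hε0, hε1⟩ := (((eventually_exists_mem_curveSpace hp hcrit hgm hgC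
    (fun t ht => indicator_of_notMem ht _)
    (by rw [intervalIntegral_eq_integral_unitMeasure, hg0]) (half_pos hη)).filter_mono
      (nhdsWithin_le_nhds (s := Ioi 0))).and (Ioo_mem_nhdsGT one_pos)).exists
  refine ⟨⟨q, hq⟩, ?_, ?_⟩
  · change amplitude (argument q) < Real.pi
    obtain ⟨s, hs, t, ht, -, h⟩ := exists_amplitude_eq (continuousOn_argument q)
    rw [h, hqa t ht, hqa s hs]
    have h1 := abs_lt.mp (hψ t ht)
    have h2 := abs_lt.mp (hψ s hs)
    have h3 := sub_le_amplitude (continuousOn_argument p) hs ht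
    rw [hcrit] at h3
    have h4 : θ₁ * (t - s) ≤ |θ₁| := by
      refine (le_abs_self _).trans ?_
      rw [abs_mul]
      refine mul_le_of_le_one_right (abs_nonneg _) (abs_le.mpr ?_)
      constructor <;> linarith [hs.1, hs.2, ht.1, ht.2]
    have h5 : (∫ x in (0 : ℝ)..t, g x) - (∫ x in (0 : ℝ)..s, g x) <
        Real.pi - (argument p t - argument p s) := by
      linarith [h1.2, h2.1]
    -- With `D = θ(t) - θ(s) ≤ π`, the new increment is less than `D + ε(π - D) ≤ π`.
    nlinarith [mul_pos hε0 (sub_pos.mpr h5), mul_nonneg (sub_nonneg.mpr hε1.le)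
      (sub_nonneg.mpr h3)]
  · rw [dist_comm, Subtype.dist_eq]
    exact hqp.trans_lt (half_lt_self hη)

lemma critical_subset_closure_diffuse {Q : ℂ × Circle} {θ₁ : ℝ} (hθ₁ : |θ₁| < Real.pi) :
    critical Q θ₁ ⊆ closure (diffuse Q θ₁) := by
  rintro ⟨p, hp⟩ (hcrit : amplitude (argument p) = Real.pi)
  rw [Metric.mem_closure_iff]
  intro η hη
  have harg1 : argument p 1 = θ₁ := by
    have := hp.2
    rwa [totalTurning, argument_zero, sub_zero] at this
  have hθ := abs_lt.mp hθ₁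
  obtain ⟨s, hs, t, ht, -, hst⟩ := exists_amplitude_eq (continuousOn_argument p)
  rw [hcrit] at hst
  have hpi := Real.pi_pos
  obtain ⟨n, g, C, hgm, hgC, hg0, hgi, hgst⟩ : ∃ (n : ℕ) (g : ℝ → ℝ) (C : ℝ), Measurable g ∧
      (∀ x, |g x| ≤ C) ∧ (∀ x ∉ boundedSet p n, g x = 0) ∧ ∫ x in (0 : ℝ)..1, g x = 0 ∧
      (∫ x in (0 : ℝ)..t, g x) - ∫ x in (0 : ℝ)..s, g x = 1 := by
    rcases lt_trichotomy s t with h | h | h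
    · refine exists_bounded_intervalIntegral_sub_eq_one p hs ht h ?_
      -- Otherwise `s = 0` and `t = 1`, so the total turning would be `π`; in the reversed case
      -- below it would be `-π`.
      by_contra! hc
      have h1 : t = 1 := by linarith [hs.1, ht.2]
      have h0 : s = 0 := by linarith [hs.1, ht.2]
      rw [h1, h0, harg1, argument_zero] at hst
      linarith [hθ.2]
    · rw [h, sub_self] at hst; exact absurd hst hpi.ne'
    · obtain ⟨n, g, C, hgm, hgC, hg0, hgi, hgst⟩ :=
        exists_bounded_intervalIntegral_sub_eq_one p ht hs h (by
          by_contra! hc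
          have h1 : s = 1 := by linarith [ht.1, hs.2]
          have h0 : t = 0 := by linarith [ht.1, hs.2]
          rw [h1, h0, harg1, argument_zero] at hst
          linarith [hθ.1])
      refine ⟨n, fun x => -g x, C, hgm.neg, fun x => by rw [abs_neg]; exact hgC x,
        fun x hx => neg_eq_zero.mpr (hg0 x hx), ?_, ?_⟩
      · rw [intervalIntegral.integral_neg, hgi, neg_zero]
      · rw [intervalIntegral.integral_neg, intervalIntegral.integral_neg]; linarith
  obtain ⟨ε, ⟨q, hq, hqp, hqa⟩, hε⟩ := (((eventually_exists_mem_curveSpace hp hcrit hgm hgC hg0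
    hgi (half_pos hη)).filter_mono (nhdsWithin_le_nhds (s := Ioi 0))).and
      self_mem_nhdsWithin).exists
  refine ⟨⟨q, hq⟩, ?_, ?_⟩
  · change Real.pi < amplitude (argument q)
    -- The old extremal times already give an increment of `π + ε`.
    refine lt_of_lt_of_le ?_ (sub_le_amplitude (continuousOn_argument q) hs ht)
    rw [hqa t ht, hqa s hs]
    have hε' : 0 < ε := hε
    linear_combination hε' + hst - ε * hgst
  · rw [dist_comm, Subtype.dist_eq]
    exact hqp.trans_lt (half_lt_self hη)

end ConstrainedCurves

end

/-! ### Boundaries and closures from the sublevel and superlevel sets of the amplitude. -/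

theorem propositionP (Q : ℂ × Circle) (θ₁ : ℝ) (hQ : Circle.exp θ₁ = Q.2) (hθ₁ : |θ₁| < Real.pi) :
    frontier (ConstrainedCurves.condensed Q θ₁) = ConstrainedCurves.critical Q θ₁ ∧
    frontier (ConstrainedCurves.diffuse Q θ₁) = ConstrainedCurves.critical Q θ₁ ∧
    closure (ConstrainedCurves.condensed Q θ₁) ∪ closure (ConstrainedCurves.diffuse Q θ₁)
      = Set.univ ∧
    closure (ConstrainedCurves.condensed Q θ₁) ∩ closure (ConstrainedCurves.diffuse Q θ₁)
      = ConstrainedCurves.critical Q θ₁ := by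
  set ω : ConstrainedCurves.curveSpace Q θ₁ → ℝ := fun p =>
    ConstrainedCurves.amplitude (ConstrainedCurves.argument p) with hω
  have hcont : Continuous ω :=
    ConstrainedCurves.continuous_amplitude_argument.comp continuous_subtype_val
  have hcT := ConstrainedCurves.critical_subset_closure_condensed (Q := Q) hθ₁
  have hdT := ConstrainedCurves.critical_subset_closure_diffuse (Q := Q) hθ₁
  have hc : closure (ConstrainedCurves.condensed Q θ₁) = {p | ω p ≤ Real.pi} := by
    refine (closure_minimal (fun p hp => le_of_lt hp)
      (isClosed_le hcont continuous_const)).antisymm fun p hp => ?_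
    rcases lt_or_eq_of_le (show ω p ≤ Real.pi from hp) with h | h
    · exact subset_closure h
    · exact hcT h
  have hd : closure (ConstrainedCurves.diffuse Q θ₁) = {p | Real.pi ≤ ω p} := by
    refine (closure_minimal (fun p hp => le_of_lt hp)
      (isClosed_le continuous_const hcont)).antisymm fun p hp => ?_
    rcases lt_or_eq_of_le (show Real.pi ≤ ω p from hp) with h | h
    · exact subset_closure h
    · exact hdT h.symm
  have hco : IsOpen (ConstrainedCurves.condensed Q θ₁) := isOpen_lt hcont continuous_const
  have hdo : IsOpen (ConstrainedCurves.diffuse Q θ₁) := isOpen_lt continuous_const hcont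
  refine ⟨?_, ?_, ?_, ?_⟩
  · rw [hco.frontier_eq, hc]
    ext p
    change ω p ≤ Real.pi ∧ ¬ ω p < Real.pi ↔ ω p = Real.pi
    rw [not_lt, le_antisymm_iff]
  · rw [hdo.frontier_eq, hd]
    ext p
    change Real.pi ≤ ω p ∧ ¬ Real.pi < ω p ↔ ω p = Real.pi
    rw [not_lt, le_antisymm_iff, and_comm]
  · rw [hc, hd]
    ext p
    simpa using le_total (ω p) Real.pi
  · rw [hc, hd]
    ext p
    exact (le_antisymm_iff (a := ω p)).symm
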